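/- Let $n\ge 0$ and let $\tilde W_n$ be the group of signed permutations $e_i\mapsto \pm e_{\pi(i)}$ of $\mathbb{Z}^n$, i.e. the Coxeter group of type $B_n$ with generators $t$ (sign change of $e_1$; $t=1$ if $n=0$) and $s_i$ (interchange of $e_i$ and $e_{i+1}$, $1\le i\le n-1$), and let $\tilde\ell$ be its length function. Let $W_n\subseteq\tilde W_n$ be the subgroup generated by $u=ts_1t$ (if $n\ge 2$) and $s_1,\dots,s_{n-1}$, the Coxeter group of type $D_n$, with root system $\Phi=\{\pm e_i\pm e_j\mid i\ne j\}$ and simple roots $e_1+e_2$ and $e_{i+1}-e_i$ ($1\le i\le n-1$). Put $w^\diamond=twt$ for $w\in W_n$ and $\alpha^\diamond=t(\alpha)$ for $\alpha\in\Phi$. Let $\delta$ be either $\diamond$ or the identity (on $W_n$ and on $\Phi$). Two elements $w,w'\in W_n$ are $\delta$-conjugate if $w'=\delta(x)wx^{-1}$ for some $x\in W_n$, and $w\in W_n$ is a $\delta$-twisted involution if $\delta(w)=w^{-1}$. For such a $w$ let $C^\delta(w)=\{x\in W_n\mid \delta(x)w=wx\}$, let $\Phi_w=\{\alpha\in\Phi\mid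 w(\alpha)=-\delta(\alpha)\}$, and for $x\in C^\delta(w)$ let $\varepsilon_w(x)=(-1)^k$ where $k$ is the number of positive $\alpha\in\Phi_w$ with $x(\alpha)$ negative. Kottwitz' character is $\Upsilon_w^\delta=\mathrm{Ind}_{C^\delta(w)}^{W_n}(\varepsilon_w)$; it is written $\Upsilon_w^1$ (split case) if $\delta$ is the identity and $\Upsilon_w^\diamond$ (quasi-split case) if $\delta=\diamond$. It depends only on the $\delta$-conjugacy class $C$ of $w$, and is also written $\Upsilon_C^\delta$. Let $\mathcal C$ be a conjugacy class of elements $\sigma\in\tilde W_n$ with $\sigma^2=1$, and let $\tilde M$ be a $\mathbb{Q}$-vector space with a basis $\{\tilde a_\sigma\mid\sigma\in\mathcal C\}$. Then there is a unique $\mathbb{Q}[\tilde W_n]$-module structure on $\tilde M$ such that $$t.\tilde a_\sigma=\tilde a_{t\sigma t},\qquad s_i.\tilde a_\sigma=\begin{cases}-\tilde a_\sigma&\text{if } s_i\sigma=\sigma s_i\text{ and }\tilde\ell(\sigma s_i)<\tilde\ell(\sigma),\\ \tilde a_{s_i\sigma s_i}&\text{otherwise,}\end{cases}$$ for all $\sigma\in\mathcal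 C$ and $1\le i\le n-1$. Let $\tilde\Upsilon_{\mathcal C}$ be the character of $\tilde W_n$ afforded by $\tilde M$. (a) If $\mathcal C\subseteq W_n$ and $\mathcal C$ is a single conjugacy class of $W_n$, then the restriction of $\tilde\Upsilon_{\mathcal C}$ to $W_n$ is $\Upsilon^1_{\mathcal C}$. (b) If $\mathcal C\subseteq W_n$ and $\mathcal C$ consists of two conjugacy classes of $W_n$, then $n$ is even and the restriction of $\tilde\Upsilon_{\mathcal C}$ to $W_n$ is $\Upsilon^1_{\sigma_{n/2}}+\Upsilon^1_{t\sigma_{n/2}t}$, where $\sigma_{n/2}=s_1s_3\cdots s_{n-1}$. (c) If $\mathcal C\subseteq W_nt$, then $C=\{t\sigma\mid\sigma\in\mathcal C\}$ is a $\diamond$-conjugacy class of $\diamond$-twisted involutions in $W_n$, and the restriction of $\tilde\Upsilon_{\mathcal C}$ to $W_n$ is $\Upsilon^\diamond_C$. -/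

import Mathlib

/-! ## Twisted involutions and Kottwitz' characters, for a finite group with a root system -/

namespace Kottwitz

section General

variable {W V : Type*} [Group W] [AddCommGroup V]

/-- `w` and `w'` are `δ`-conjugate: `w' = δ(x) w x⁻¹` for some `x`. -/
def IsTwistedConj (δ : W ≃* W) (w w' : W) : Prop :=
  ∃ x : W, w' = δ x * w * x⁻¹

/-- `K` is a single `δ`-conjugacy class. -/
def IsTwistedConjClass (δ : W ≃* W) (K : Set W) : Prop :=
  ∃ w : W, K = {w' | IsTwistedConj δ w w'}

/-- `w` is a `δ`-twisted involution: `δ(w) = w⁻¹`. -/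
def IsTwistedInvolution (δ : W ≃* W) (w : W) : Prop :=
  δ w = w⁻¹

/-- The `δ`-centraliser `{x | δ(x) w = w x}` of `w`. -/
def twistedCentralizer (δ : W ≃* W) (w : W) : Subgroup W where
  carrier := {x | δ x * w = w * x}
  mul_mem' := by
    intro x y hx hy
    simp only [Set.mem_ofPred_eq] at hx hy ⊢
    rw [map_mul, mul_assoc, hy, ← mul_assoc, hx, mul_assoc]
  one_mem' := by simp
  inv_mem' := by
    intro x hx
    simp only [Set.mem_ofPred_eq] at hx ⊢
    rw [map_inv, inv_mul_eq_iff_eq_mul, ← mul_assoc, hx, mul_inv_cancel_right]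

/-- The set `Φ_w` of roots `α` with `w(α) = -θ(α)`. Here `W` acts on `V ⊇ Φ` through `r`, and
`θ` is the map induced on roots by the automorphism of `W`. -/
def twistedRoots (r : Representation ℤ W V) (θ : V → V) (Φ : Set V) (w : W) : Set V :=
  {α | α ∈ Φ ∧ r w α = -θ α}

/-- The sign `(-1)^k`, where `k` is the number of positive roots `α ∈ Φ_w` such that `x(α)` is
negative. -/
noncomputable def kottwitzSign (r : Representation ℤ W V) (θ : V → V) (Φ pos : Set V)
    (w x : W) : ℚ :=
  (-1) ^ Set.ncard {α | α ∈ twistedRoots r θ Φ w ∧ α ∈ pos ∧ -(r x α) ∈ pos}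

open Classical in
/-- The class function on `G` induced from a class function `ψ` on the subgroup `H`
(for a finite group `G`). -/
noncomputable def inducedClassFunction {G : Type*} [Group G] (H : Subgroup G) (ψ : H → ℚ)
    (g : G) : ℚ :=
  (Nat.card H : ℚ)⁻¹ * ∑ᶠ x : G, if h : x⁻¹ * g * x ∈ H then ψ ⟨x⁻¹ * g * x, h⟩ else 0

/-- Kottwitz' character `Υ_w^δ`: the class function on `W` induced from the sign character of the
`δ`-centraliser of `w`. -/
noncomputable def kottwitzCharacter (δ : W ≃* W) (r : Representation ℤ W V) (θ : V → V)
    (Φ pos : Set V) (w : W) : W → ℚ :=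
  inducedClassFunction (twistedCentralizer δ w) fun x => kottwitzSign r θ Φ pos w (x : W)

end General

end Kottwitz

/-! ## The Coxeter group of type `B_n` as the group of signed permutations -/

/-- A signed permutation of `n` letters: the linear map `e_i ↦ sign i • e_{perm i}`. -/
@[ext]
structure SignedPerm (n : ℕ) where
  perm : Equiv.Perm (Fin n)
  sign : Fin n → ℤˣ

namespace SignedPerm

variable {n : ℕ}

/-- Composition of signed permutations, as linear maps. -/
instance : Mul (SignedPerm n) :=
  ⟨fun v w => ⟨v.perm * w.perm, fun i => v.sign (w.perm i) * w.sign i⟩⟩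

instance : One (SignedPerm n) := ⟨⟨1, fun _ => 1⟩⟩

instance : Inv (SignedPerm n) := ⟨fun w => ⟨w.perm⁻¹, fun i => (w.sign (w.perm⁻¹ i))⁻¹⟩⟩

@[simp] theorem mul_perm (v w : SignedPerm n) : (v * w).perm = v.perm * w.perm := rfl
@[simp] theorem mul_sign (v w : SignedPerm n) (i : Fin n) :
    (v * w).sign i = v.sign (w.perm i) * w.sign i := rfl
@[simp] theorem one_perm : (1 : SignedPerm n).perm = 1 := rfl
@[simp] theorem one_sign (i : Fin n) : (1 : SignedPerm n).sign i = 1 := rfl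
@[simp] theorem inv_perm (w : SignedPerm n) : (w⁻¹).perm = w.perm⁻¹ := rfl
@[simp] theorem inv_sign (w : SignedPerm n) (i : Fin n) :
    (w⁻¹).sign i = (w.sign (w.perm⁻¹ i))⁻¹ := rfl

instance : Group (SignedPerm n) :=
  Group.ofLeftAxioms
    (fun a b c => by ext i <;> simp [mul_assoc])
    (fun a => by ext i <;> simp)
    (fun a => by ext i <;> simp)

/-- The reflection representation on `ℤⁿ`: `w(e_i) = sign i • e_{perm i}`. -/
def reflectionRep (n : ℕ) : Representation ℤ (SignedPerm n) (Fin n → ℤ) where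
  toFun w :=
    { toFun := fun v j => (w.sign (w.perm⁻¹ j) : ℤ) * v (w.perm⁻¹ j)
      map_add' := fun v v' => by ext j; simp [mul_add]
      map_smul' := fun c v => by ext j; simp [mul_left_comm] }
  map_one' := by ext i j; simp
  map_mul' v w := by
    refine LinearMap.ext fun x => funext fun j => ?_
    simp [mul_assoc]

/-- The generator `t`: the sign change of the first basis vector. -/
def t (n : ℕ) : SignedPerm n := ⟨1, fun i => if (i : ℕ) = 0 then -1 else 1⟩

/-- The generators `s_1, …, s_{n-1}`, indexed from `0`: `s i` interchanges the basis vectors with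
(zero-based) indices `i` and `i + 1`. -/
def s (i : Fin (n - 1)) : SignedPerm n :=
  ⟨Equiv.swap ⟨i, by omega⟩ ⟨i + 1, by omega⟩, fun _ => 1⟩

/-- The set of generators `{t, s_1, …, s_{n-1}}`. -/
def generators (n : ℕ) : Set (SignedPerm n) := {t n} ∪ Set.range s

/-- The length with respect to `t, s_1, …, s_{n-1}`: the least length of a word in the generators
with product `w`. -/
noncomputable def length (w : SignedPerm n) : ℕ :=
  sInf {k | ∃ l : List (SignedPerm n), (∀ g ∈ l, g ∈ generators n) ∧ l.prod = w ∧ l.length = k}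

/-! ### The subgroup of type `D_n` and its root system -/

/-- The generators `u = t s_1 t` (present only if `n ≥ 2`) and `s_1, …, s_{n-1}`. -/
def dGenerators (n : ℕ) : Set (SignedPerm n) :=
  {w | ∃ h : 0 < n - 1, w = t n * s ⟨0, h⟩ * t n} ∪ Set.range s

/-- The Coxeter group `W_n` of type `D_n`, as a subgroup of the group of type `B_n`. -/
def D (n : ℕ) : Subgroup (SignedPerm n) := Subgroup.closure (dGenerators n)

theorem t_mul_t (n : ℕ) : t n * t n = 1 := by
  ext i
  · simp [t]
  · by_cases h : (i : ℕ) = 0 <;> simp [t, h]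

theorem t_conj_mem {w : SignedPerm n} (hw : w ∈ D n) : t n * w * t n ∈ D n := by
  have key : ∀ a b : SignedPerm n,
      t n * (a * b) * t n = (t n * a * t n) * (t n * b * t n) := by
    intro a b
    have : (t n * a * t n) * (t n * b * t n) = t n * a * (t n * t n) * b * t n := by
      simp only [mul_assoc]
    rw [this, t_mul_t]; simp only [mul_assoc, mul_one]
  unfold D at hw ⊢
  induction hw using Subgroup.closure_induction with
  | mem x hx =>
    rcases hx with ⟨h, rfl⟩ | ⟨i, rfl⟩
    · have : t n * (t n * s ⟨0, h⟩ * t n) * t n = s ⟨0, h⟩ := by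
        have e : t n * (t n * s ⟨0, h⟩ * t n) * t n
            = (t n * t n) * s ⟨0, h⟩ * (t n * t n) := by simp only [mul_assoc]
        rw [e, t_mul_t]; simp
      rw [this]
      exact Subgroup.subset_closure (Or.inr ⟨_, rfl⟩)
    · by_cases hi : (i : ℕ) = 0
      · have h : 0 < n - 1 := by have := i.2; omega
        have : i = ⟨0, h⟩ := Fin.ext hi
        subst this
        exact Subgroup.subset_closure (Or.inl ⟨h, rfl⟩)
      · have : t n * s i * t n = s i := by
          refine SignedPerm.ext (by simp [t]) (funext fun j => ?_)
          have hsw : ((Equiv.swap (⟨i, by omega⟩ : Fin n) ⟨i + 1, by omega⟩ j : Fin n) : ℕ) = 0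
              ↔ (j : ℕ) = 0 := by
            rw [Equiv.swap_apply_def]
            split_ifs with h1 h2
            · subst h1; simp [hi]
            · subst h2; simp [hi]
            · rfl
          simp only [mul_sign, t, s, Equiv.Perm.one_apply, hsw]
          by_cases hj : (j : ℕ) = 0 <;> simp [hj]
        rw [this]
        exact Subgroup.subset_closure (Or.inr ⟨_, rfl⟩)
  | one => rw [mul_one, t_mul_t]; exact Subgroup.one_mem _
  | mul x y _ _ hx hy => rw [key]; exact Subgroup.mul_mem _ hx hy
  | inv x _ hx =>
    have : t n * x⁻¹ * t n = (t n * x * t n)⁻¹ := by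
      have ht : (t n)⁻¹ = t n := inv_eq_of_mul_eq_one_left (t_mul_t n)
      simp only [mul_inv_rev, ht, mul_assoc]
    rw [this]; exact Subgroup.inv_mem _ hx

theorem t_conj_t_conj (w : SignedPerm n) : t n * (t n * w * t n) * t n = w := by
  have e : t n * (t n * w * t n) * t n = (t n * t n) * w * (t n * t n) := by
    simp only [mul_assoc]
  rw [e, t_mul_t]; simp

/-- The automorphism `w ↦ w^⋄ = t w t` of `W_n`. It exchanges `u` and `s_1` and fixes
`s_2, …, s_{n-1}`. -/
def diamond (n : ℕ) : D n ≃* D n where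
  toFun w := ⟨t n * w * t n, t_conj_mem w.2⟩
  invFun w := ⟨t n * w * t n, t_conj_mem w.2⟩
  left_inv w := Subtype.ext (t_conj_t_conj _)
  right_inv w := Subtype.ext (t_conj_t_conj _)
  map_mul' v w := Subtype.ext (by
    change t n * ((v : SignedPerm n) * w) * t n = (t n * v * t n) * (t n * w * t n)
    have e : (t n * (v : SignedPerm n) * t n) * (t n * w * t n)
        = t n * v * (t n * t n) * w * t n := by simp only [mul_assoc]
    rw [e, t_mul_t]; simp only [mul_assoc, mul_one])

/-- The action of `W_n` on `ℤⁿ`. -/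
def dRep (n : ℕ) : Representation ℤ (D n) (Fin n → ℤ) :=
  (reflectionRep n).comp (D n).subtype

/-- The root system of type `D_n`: the vectors `±e_i ± e_j` with `i ≠ j`. -/
def dRoots (n : ℕ) : Set (Fin n → ℤ) :=
  {α | ∃ i j : Fin n, i ≠ j ∧ ∃ a b : ℤˣ,
    α = Pi.single i (a : ℤ) + Pi.single j (b : ℤ)}

/-- The simple roots: `e_1 + e_2` (for `u`) and `e_{i+1} - e_i` (for `s_i`). -/
def dSimpleRoots (n : ℕ) : Set (Fin n → ℤ) :=
  {α | ∃ h : 0 < n - 1, α = Pi.single ⟨0, by omega⟩ 1 + Pi.single ⟨1, by omega⟩ 1} ∪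
  {α | ∃ i : Fin (n - 1), α = Pi.single ⟨i + 1, by omega⟩ 1 - Pi.single ⟨i, by omega⟩ 1}

/-- The positive roots: the roots that are sums of simple roots. -/
def dPosRoots (n : ℕ) : Set (Fin n → ℤ) :=
  {α | α ∈ dRoots n ∧ α ∈ AddSubmonoid.closure (dSimpleRoots n)}

/-- Kottwitz' character `Υ_w^1` of `W_n` (split case: the trivial automorphism). -/
noncomputable def splitCharacter (w : D n) : D n → ℚ :=
  Kottwitz.kottwitzCharacter (MulEquiv.refl (D n)) (dRep n) id (dRoots n) (dPosRoots n) w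

/-- Kottwitz' character `Υ_w^⋄` of `W_n` (quasi-split case: `w^⋄ = t w t`, `α^⋄ = t(α)`). -/
noncomputable def quasiSplitCharacter (w : D n) : D n → ℚ :=
  Kottwitz.kottwitzCharacter (diamond n) (dRep n) (reflectionRep n (t n)) (dRoots n)
    (dPosRoots n) w

/-- The generator `s_i`, as an element of `W_n`. -/
def sD (i : Fin (n - 1)) : D n :=
  ⟨s i, Subgroup.subset_closure (Or.inr ⟨i, rfl⟩)⟩

/-- The element `σ_{n/2} = s_1 s_3 ⋯ s_{n-1}` of `W_n`, for even `n`. -/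
def sigmaHalf (n : ℕ) : D n :=
  (List.ofFn fun k : Fin (n / 2) => sD (n := n) ⟨2 * k, by omega⟩).prod

/-! ### The module attached to a conjugacy class of `B_n` -/

/-- The conjugate `x σ x⁻¹`, as an element of the conjugacy class of `σ`. -/
def conjBy {C : ConjClasses (SignedPerm n)} (x : SignedPerm n) (σ : C.carrier) : C.carrier :=
  ⟨x * σ * x⁻¹, by
    have hσ := ConjClasses.mem_carrier_iff_mk_eq.1 σ.2
    refine ConjClasses.mem_carrier_iff_mk_eq.2 (Eq.trans ?_ hσ)
    rw [ConjClasses.mk_eq_mk_iff_isConj]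
    exact (isConj_iff.2 ⟨x, rfl⟩ : IsConj (σ : SignedPerm n) _).symm⟩

open Classical in
/-- The representation `ρ` on a space with basis `(b_σ)_{σ ∈ C}` is given on the generators by
`t.b_σ = b_{tσt}`; `s_i.b_σ = -b_σ` if `s_i σ = σ s_i` and `ℓ(σ s_i) < ℓ(σ)`, and
`s_i.b_σ = b_{s_i σ s_i}` otherwise. (Recall `t⁻¹ = t` and `s_i⁻¹ = s_i`.) -/
def IsInvolutionModule {C : ConjClasses (SignedPerm n)} {M : Type*} [AddCommGroup M] [Module ℚ M]
    (b : Module.Basis C.carrier ℚ M) (ρ : Representation ℚ (SignedPerm n) M) : Prop :=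
  (∀ σ : C.carrier, ρ (t n) (b σ) = b (conjBy (t n) σ)) ∧
  ∀ (i : Fin (n - 1)) (σ : C.carrier),
    ρ (s i) (b σ) =
      if s i * σ = σ * s i ∧ length ((σ : SignedPerm n) * s i) < length (σ : SignedPerm n)
      then -b σ else b (conjBy (s i) σ)

end SignedPerm

/-!
For an element `σ` of a conjugacy class `C` of `B_n` and an arbitrary signed permutation `x`, the
sign `(-1)^k`, with `k` the number of positive roots `α` such that `σ(α) = -α` and `x(α) < 0`, is a
`1`-cocycle for the conjugation action on `C`. Hence `x.b_σ = ± b_{xσx⁻¹}` defines a monomial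
representation, and on the generators it is the required module: `t` makes no positive root of `D_n`
negative, `s_i` only its simple root, and `σ` negates that root exactly when `s_i` commutes with `σ`
and `ℓ(σ s_i) < ℓ(σ)`.

The restriction of a monomial representation to a subgroup is the sum, over the orbits of the
subgroup, of the representations induced from the sign on a point stabiliser. In `W_n` the
stabiliser of `σ = w`, respectively `σ = t w`, is the centraliser, respectively the `⋄`-centraliser,
of `w`, with Kottwitz' sign on it. There is a single orbit when some element of `W_n t` commutes
with some `σ ∈ C`, and the two orbits of `σ` and `tσt` otherwise. Changing the sign of an odd number
of basis vectors shows that in the latter case the permutation underlying `σ` stabilises no set of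
odd size; if `σ` is an involution, it is then conjugate to `σ_{n/2}`.
-/

namespace Kottwitz

theorem nonempty_carrier {G : Type*} [Monoid G] (C : ConjClasses G) : C.carrier.Nonempty :=
  C.exists_rep.imp fun _ => ConjClasses.mem_carrier_iff_mk_eq.2

section Monomial

variable {G X k M : Type*} [Group G] [MulAction G X]

/-- `c` is a multiplicative `1`-cocycle for the action of `G` on `X`, which is what makes
`g.b_x = c g x • b_{g • x}` an action on a module with basis `(b_x)`. -/
structure IsCocycle [Monoid k] (c : G → X → k) : Prop where
  one (x : X) : c 1 x = 1
  mul (g h : G) (x : X) : c (g * h) x = c g (h • x) * c h x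

theorem IsCocycle.restrict [Monoid k] {c : G → X → k} (hc : IsCocycle c) (H : Subgroup G) :
    IsCocycle fun (h : H) (x : X) => c h x where
  one := hc.one
  mul g h := hc.mul g h

/-- The monomial representation `g.b_x = c g x • b_{g • x}` attached to a cocycle `c`. -/
noncomputable def monomialRep [CommSemiring k] [AddCommMonoid M] [Module k M] {c : G → X → k}
    (hc : IsCocycle c) (b : Module.Basis X k M) : Representation k G M where
  toFun g := b.constr k fun x => c g x • b (g • x)
  map_one' := b.ext fun x => by simp [hc.one]
  map_mul' g h := b.ext fun x => by
    simp only [Module.End.mul_apply, Module.Basis.constr_basis, map_smul, hc.mul]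
    rw [smul_smul, ← mul_smul g h x, mul_comm]

theorem monomialRep_apply_basis [CommSemiring k] [AddCommMonoid M] [Module k M] {c : G → X → k}
    (hc : IsCocycle c) (b : Module.Basis X k M) (g : G) (x : X) :
    monomialRep hc b g (b x) = c g x • b (g • x) :=
  b.constr_basis k _ x

theorem character_monomialRep [Field k] [AddCommGroup M] [Module k M] [Finite X] {c : G → X → k}
    (hc : IsCocycle c) (b : Module.Basis X k M) (g : G) :
    (monomialRep hc b).character g = ∑ᶠ x ∈ MulAction.fixedBy X g, c g x := by
  classical
  have := Fintype.ofFinite X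
  rw [finsum_mem_def, finsum_eq_sum_of_fintype, Representation.character,
    LinearMap.trace_eq_matrix_trace k b, Matrix.trace]
  refine Finset.sum_congr rfl fun x _ => ?_
  simp [LinearMap.toMatrix_apply, monomialRep_apply_basis, Set.indicator_apply,
    Finsupp.single_apply]

theorem sum_smul_eq_card_stabilizer_mul_finsum [Fintype G] [Semiring k] (x : X) (f : X → k) :
    ∑ g : G, f (g • x) =
      Nat.card (MulAction.stabilizer G x) * ∑ᶠ y ∈ MulAction.orbit G x, f y := by
  have : Finite (MulAction.orbit G x) := Set.finite_range _
  have := Fintype.ofFinite (MulAction.orbit G x)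
  have := Fintype.ofFinite (MulAction.stabilizer G x)
  let e := (MulAction.orbitProdStabilizerEquivGroup G x).symm
  have orbit_part (g : G) : ((e g).1 : X) = g • x :=
    MulAction.orbitEquivQuotientStabilizer_symm_apply G x g
  simp only [← orbit_part]
  rw [e.sum_comp fun p => f p.1, Fintype.sum_prod_type, ← finsum_set_coe_eq_finsum_mem,
    finsum_eq_sum_of_fintype, Nat.card_eq_fintype_card, Finset.mul_sum]
  simp only [Finset.sum_const, Finset.card_univ, nsmul_eq_mul]

theorem inducedClassFunction_stabilizer [Finite G] {c : G → X → ℚ} (hc : IsCocycle c) (x : X)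
    (g : G) :
    inducedClassFunction (MulAction.stabilizer G x) (fun h => c h x) g =
      ∑ᶠ y ∈ MulAction.orbit G x ∩ MulAction.fixedBy X g, c g y := by
  classical
  have := Fintype.ofFinite G
  have mem_iff (y : G) : y⁻¹ * g * y ∈ MulAction.stabilizer G x ↔
      y • x ∈ MulAction.fixedBy X g := by
    rw [MulAction.mem_stabilizer_iff, MulAction.mem_fixedBy, mul_smul, mul_smul,
      inv_smul_eq_iff]
  have cocycle_conj {y : G} (h : y • x ∈ MulAction.fixedBy X g) :
      c (y⁻¹ * g * y) x = c g (y • x) := by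
    have cancel : c y⁻¹ (y • x) * c y x = 1 := by rw [← hc.mul, inv_mul_cancel, hc.one]
    rw [hc.mul, hc.mul, MulAction.mem_fixedBy.1 h, mul_right_comm, cancel, one_mul]
  rw [inducedClassFunction, finsum_eq_sum_of_fintype, inv_mul_eq_iff_eq_mul₀
    (Nat.cast_ne_zero.2 Nat.card_pos.ne'), finsum_mem_def, ← Set.indicator_indicator,
    ← finsum_mem_def, ← sum_smul_eq_card_stabilizer_mul_finsum]
  refine Finset.sum_congr rfl fun y _ => ?_
  rw [Set.indicator_apply]
  split_ifs with h₁ h₂ h₂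
  · exact cocycle_conj h₂
  · exact absurd ((mem_iff y).1 h₁) h₂
  · exact absurd ((mem_iff y).2 h₂) h₁
  · rfl

end Monomial

section PositiveSystem

variable {G V : Type*} [Group G] [AddCommGroup V]

/-- `Φ` is a finite `G`-stable set with `Φ = -Φ`, and `pos` contains exactly one of `α`, `-α` for
each `α ∈ Φ`: the properties of a root system and its positive roots that make `kottwitzSign` a
cocycle. -/
structure IsPositiveSystem (r : Representation ℤ G V) (Φ pos : Set V) : Prop where
  finite : Φ.Finite
  map_mem (x : G) {α : V} : α ∈ Φ → r x α ∈ Φ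
  neg_mem {α : V} : α ∈ Φ → -α ∈ Φ
  mem_iff_neg_notMem {α : V} : α ∈ Φ → (α ∈ pos ↔ -α ∉ pos)

open Classical in
/-- The sign of a root: `-1` if it is negative, `1` if it is positive. -/
noncomputable def rootSign (pos : Set V) (α : V) : ℤˣ := if -α ∈ pos then -1 else 1

theorem kottwitzSign_eq_finprod (r : Representation ℤ G V) (θ : V → V) {Φ : Set V}
    (hΦ : Φ.Finite) (pos : Set V) (w x : G) :
    kottwitzSign r θ Φ pos w x =
      ∏ᶠ α ∈ twistedRoots r θ Φ w ∩ pos, ((rootSign pos (r x α) : ℤ) : ℚ) := by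
  classical
  have hfin : (twistedRoots r θ Φ w ∩ pos).Finite := hΦ.subset fun α hα => hα.1.1
  have hset : {α | α ∈ twistedRoots r θ Φ w ∧ α ∈ pos ∧ -(r x α) ∈ pos} =
      (hfin.toFinset.filter fun α => -(r x α) ∈ pos : Finset V) := by
    ext α
    simp [and_assoc]
  rw [kottwitzSign, hset, Set.ncard_coe_finset, finprod_mem_eq_finite_toFinset_prod _ hfin,
    ← Finset.prod_const, Finset.prod_filter]
  refine Finset.prod_congr rfl fun α _ => ?_
  unfold rootSign
  split_ifs <;> norm_num

variable {r : Representation ℤ G V} {Φ pos : Set V} (h : IsPositiveSystem r Φ pos)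
include h

theorem IsPositiveSystem.rootSign_smul_mem {α : V} (hα : α ∈ Φ) :
    rootSign pos α • α ∈ Φ ∩ pos := by
  unfold rootSign
  split_ifs with hneg
  · rw [Units.neg_smul, one_smul]
    exact ⟨h.neg_mem hα, hneg⟩
  · rw [one_smul]
    exact ⟨hα, (h.mem_iff_neg_notMem hα).2 hneg⟩

theorem IsPositiveSystem.rootSign_units_smul {α : V} (hα : α ∈ Φ) (u : ℤˣ) :
    rootSign pos (u • α) = u * rootSign pos α := by
  rcases Int.units_eq_one_or u with rfl | rfl
  · rw [one_smul, one_mul]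
  · rw [Units.neg_smul, one_smul, rootSign, neg_neg, h.mem_iff_neg_notMem hα, rootSign]
    split_ifs <;> rfl

theorem IsPositiveSystem.rootSign_eq_one {α : V} (hα : α ∈ Φ) (hpos : α ∈ pos) :
    rootSign pos α = 1 :=
  if_neg ((h.mem_iff_neg_notMem hα).1 hpos)

theorem kottwitzSign_one (σ : G) : kottwitzSign r id Φ pos σ 1 = 1 := by
  rw [kottwitzSign_eq_finprod r id h.finite]
  refine finprod_mem_eq_one_of_forall_eq_one fun α hα => ?_
  rw [map_one, Module.End.one_apply, h.rootSign_eq_one hα.1.1 hα.2, Units.val_one, Int.cast_one]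

theorem IsPositiveSystem.bijOn_rootSign_smul (σ y : G) :
    Set.BijOn (fun α => rootSign pos (r y α) • r y α) (twistedRoots r id Φ σ ∩ pos)
      (twistedRoots r id Φ (y * σ * y⁻¹) ∩ pos) := by
  let f (z : G) (α : V) : V := rootSign pos (r z α) • r z α
  have maps (τ z : G) : Set.MapsTo (f z) (twistedRoots r id Φ τ ∩ pos)
      (twistedRoots r id Φ (z * τ * z⁻¹) ∩ pos) := by
    rintro α ⟨⟨hα, hneg⟩, -⟩
    have hmem := h.rootSign_smul_mem (h.map_mem z hα)
    refine ⟨⟨hmem.1, ?_⟩, hmem.2⟩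
    rw [id_eq] at hneg ⊢
    simp only [f, Units.smul_def, map_smul, map_mul, Module.End.mul_apply,
      Representation.inv_self_apply, hneg, map_neg, smul_neg]
  have inv (τ z : G) : Set.LeftInvOn (f z⁻¹) (f z) (twistedRoots r id Φ τ ∩ pos) := by
    rintro α ⟨⟨hα, -⟩, hpos⟩
    simp only [f, Units.smul_def, map_smul, Representation.inv_self_apply]
    simp only [← Units.smul_def, h.rootSign_units_smul hα, h.rootSign_eq_one hα hpos, mul_one,
      smul_smul, Int.units_mul_self, one_smul]
  have conj_conj : y⁻¹ * (y * σ * y⁻¹) * y⁻¹⁻¹ = σ := by group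
  have maps_inv := maps (y * σ * y⁻¹) y⁻¹
  have right_inv := inv (y * σ * y⁻¹) y⁻¹
  rw [inv_inv] at right_inv
  rw [conj_conj] at maps_inv
  exact Set.InvOn.bijOn ⟨inv σ y, right_inv⟩ (maps σ y) maps_inv

theorem kottwitzSign_mul (σ x y : G) :
    kottwitzSign r id Φ pos σ (x * y) =
      kottwitzSign r id Φ pos (y * σ * y⁻¹) x * kottwitzSign r id Φ pos σ y := by
  simp only [kottwitzSign_eq_finprod r id h.finite]
  rw [← finprod_mem_eq_of_bijOn _ (h.bijOn_rootSign_smul σ y) fun α _ => rfl,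
    ← finprod_mem_mul_distrib (h.finite.subset fun α hα => hα.1.1)]
  refine finprod_mem_congr rfl fun α hα => ?_
  rw [Units.smul_def (rootSign pos (r y α)), map_smul, ← Units.smul_def,
    h.rootSign_units_smul (h.map_mem x (h.map_mem y hα.1.1)), map_mul, Module.End.mul_apply]
  norm_cast
  rw [mul_right_comm, Int.units_mul_self, one_mul]

end PositiveSystem

end Kottwitz

namespace SignedPerm

open Kottwitz

variable {n : ℕ}

/-! ### Roots of type `D_n` -/

theorem reflectionRep_apply (w : SignedPerm n) (v : Fin n → ℤ) (j : Fin n) :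
    reflectionRep n w v j = (w.sign (w.perm⁻¹ j) : ℤ) * v (w.perm⁻¹ j) := rfl

theorem reflectionRep_single (w : SignedPerm n) (i : Fin n) (c : ℤ) :
    reflectionRep n w (Pi.single i c) = Pi.single (w.perm i) ((w.sign i : ℤ) * c) := by
  ext j
  obtain ⟨k, rfl⟩ := w.perm.surjective j
  rcases eq_or_ne k i with rfl | hk
  · simp [reflectionRep_apply]
  · simp [reflectionRep_apply, hk]

theorem reflectionRep_injective : Function.Injective (reflectionRep n) := by
  intro v w h
  have image_single (i : Fin n) :
      (Pi.single (v.perm i) (v.sign i : ℤ) : Fin n → ℤ) = Pi.single (w.perm i) (w.sign i) := by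
    simpa only [reflectionRep_single, mul_one] using congr($h (Pi.single i 1))
  have perm_eq (i : Fin n) : v.perm i = w.perm i := by
    by_contra hne
    simpa [Pi.single_eq_of_ne hne] using congrFun (image_single i) (v.perm i)
  have sign_eq (i : Fin n) : v.sign i = w.sign i := by
    simpa [perm_eq, Units.val_inj] using congrFun (image_single i) (w.perm i)
  exact SignedPerm.ext (Equiv.ext perm_eq) (funext sign_eq)

theorem reflectionRep_mul_apply (x y : SignedPerm n) (v : Fin n → ℤ) :
    reflectionRep n (x * y) v = reflectionRep n x (reflectionRep n y v) := by
  rw [map_mul, Module.End.mul_apply]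

theorem dotProduct_reflectionRep (w : SignedPerm n) (u v : Fin n → ℤ) :
    reflectionRep n w u ⬝ᵥ reflectionRep n w v = u ⬝ᵥ v := by
  unfold dotProduct
  rw [← Equiv.sum_comp w.perm]
  refine Finset.sum_congr rfl fun i _ => ?_
  rw [reflectionRep_apply, reflectionRep_apply, Equiv.Perm.inv_def, Equiv.symm_apply_apply,
    mul_mul_mul_comm, ← Units.val_mul, Int.units_mul_self, Units.val_one, one_mul]

/-- The linear form `e_i ↦ i` (zero-based). It takes the value `1` on every simple root, so its
sign separates the positive from the negative roots. -/
def height (n : ℕ) : (Fin n → ℤ) →ₗ[ℤ] ℤ := ∑ i : Fin n, (i : ℤ) • LinearMap.proj i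

theorem height_apply (v : Fin n → ℤ) : height n v = ∑ i : Fin n, (i : ℤ) * v i := by
  simp [height]

@[simp]
theorem height_single (i : Fin n) (c : ℤ) : height n (Pi.single i c) = i * c := by
  rw [height_apply, Finset.sum_eq_single i] <;> simp +contextual

theorem finite_dRoots (n : ℕ) : (dRoots n).Finite := by
  refine (Set.finite_range fun p : (Fin n × Fin n) × (ℤˣ × ℤˣ) =>
    (Pi.single p.1.1 (p.2.1 : ℤ) + Pi.single p.1.2 (p.2.2 : ℤ) : Fin n → ℤ)).subset ?_
  rintro _ ⟨i, j, -, a, b, rfl⟩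
  exact ⟨((i, j), (a, b)), rfl⟩

theorem reflectionRep_mem_dRoots (w : SignedPerm n) {α : Fin n → ℤ} (hα : α ∈ dRoots n) :
    reflectionRep n w α ∈ dRoots n := by
  obtain ⟨i, j, hij, a, b, rfl⟩ := hα
  exact ⟨w.perm i, w.perm j, w.perm.injective.ne hij, w.sign i * a, w.sign j * b, by
    simp only [map_add, reflectionRep_single, Units.val_mul]⟩

theorem neg_mem_dRoots {α : Fin n → ℤ} (hα : α ∈ dRoots n) : -α ∈ dRoots n := by
  obtain ⟨i, j, hij, a, b, rfl⟩ := hα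
  exact ⟨i, j, hij, -a, -b, by simp only [Units.val_neg, Pi.single_neg, neg_add]⟩

theorem dotProduct_self_of_mem_dRoots {α : Fin n → ℤ} (hα : α ∈ dRoots n) : α ⬝ᵥ α = 2 := by
  obtain ⟨i, j, hij, a, b, rfl⟩ := hα
  simp [hij, hij.symm, ← Units.val_mul, Int.units_mul_self]

theorem eq_of_two_le_dotProduct {α β : Fin n → ℤ} (hα : α ∈ dRoots n) (hβ : β ∈ dRoots n)
    (h : 2 ≤ α ⬝ᵥ β) : α = β := by
  have norm_sub : (α - β) ⬝ᵥ (α - β) = 4 - 2 * (α ⬝ᵥ β) := by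
    rw [sub_dotProduct, dotProduct_sub, dotProduct_sub, dotProduct_comm β α,
      dotProduct_self_of_mem_dRoots hα, dotProduct_self_of_mem_dRoots hβ]
    ring
  have norm_nonneg : 0 ≤ (α - β) ⬝ᵥ (α - β) := Finset.sum_nonneg fun i _ => mul_self_nonneg _
  exact sub_eq_zero.1 (dotProduct_self_eq_zero.1 (by omega))

theorem height_ne_zero {α : Fin n → ℤ} (hα : α ∈ dRoots n) : height n α ≠ 0 := by
  obtain ⟨i, j, hij, a, b, rfl⟩ := hα
  have : (i : ℕ) ≠ j := Fin.val_ne_of_ne hij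
  rcases Int.units_eq_one_or a with rfl | rfl <;> rcases Int.units_eq_one_or b with rfl | rfl <;>
    simp <;> omega

theorem single_sub_single_mem_closure {i j : ℕ} (hij : i ≤ j) (hj : j < n) :
    (Pi.single ⟨j, hj⟩ 1 - Pi.single ⟨i, hij.trans_lt hj⟩ 1 : Fin n → ℤ) ∈
      AddSubmonoid.closure (dSimpleRoots n) := by
  induction j, hij using Nat.le_induction with
  | base => rw [sub_self]; exact zero_mem _
  | succ k hk ih =>
    have simple : (Pi.single ⟨k + 1, hj⟩ 1 - Pi.single ⟨k, by omega⟩ 1 : Fin n → ℤ) ∈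
        AddSubmonoid.closure (dSimpleRoots n) :=
      AddSubmonoid.subset_closure (Or.inr ⟨⟨k, by omega⟩, rfl⟩)
    rw [← sub_add_sub_cancel]
    exact add_mem simple (ih (by omega))

theorem single_add_single_mem_closure {i j : Fin n} (hij : i < j) :
    (Pi.single i 1 + Pi.single j 1 : Fin n → ℤ) ∈ AddSubmonoid.closure (dSimpleRoots n) := by
  have hj : 1 ≤ (j : ℕ) := Nat.one_le_of_lt (Fin.lt_def.1 hij)
  have simple : (Pi.single ⟨0, by omega⟩ 1 + Pi.single ⟨1, by omega⟩ 1 : Fin n → ℤ) ∈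
      AddSubmonoid.closure (dSimpleRoots n) :=
    AddSubmonoid.subset_closure (Or.inl ⟨by omega, rfl⟩)
  convert add_mem (add_mem simple (single_sub_single_mem_closure i.1.zero_le i.2))
    (single_sub_single_mem_closure hj j.2) using 1
  rw [Fin.eta, Fin.eta]
  abel

theorem mem_closure_of_height_pos {i j : Fin n} (hij : i < j) (a b : ℤˣ)
    (h : 0 < height n (Pi.single i (a : ℤ) + Pi.single j (b : ℤ))) :
    (Pi.single i (a : ℤ) + Pi.single j (b : ℤ) : Fin n → ℤ) ∈
      AddSubmonoid.closure (dSimpleRoots n) := by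
  have hij' : (i : ℕ) < j := hij
  obtain rfl : b = 1 := by
    refine (Int.units_eq_one_or b).resolve_right ?_
    rintro rfl
    rcases Int.units_eq_one_or a with rfl | rfl <;> simp at h <;> omega
  rcases Int.units_eq_one_or a with rfl | rfl
  · exact single_add_single_mem_closure hij
  · simpa [Pi.single_neg, neg_add_eq_sub] using single_sub_single_mem_closure hij'.le j.2

theorem height_nonneg_of_mem_closure {α : Fin n → ℤ}
    (hα : α ∈ AddSubmonoid.closure (dSimpleRoots n)) : 0 ≤ height n α := by
  induction hα using AddSubmonoid.closure_induction with
  | mem x hx => rcases hx with ⟨h, rfl⟩ | ⟨i, rfl⟩ <;> simp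
  | zero => rw [map_zero]
  | add x y _ _ hx hy => rw [map_add]; exact add_nonneg hx hy

theorem mem_dPosRoots_iff {α : Fin n → ℤ} :
    α ∈ dPosRoots n ↔ α ∈ dRoots n ∧ 0 < height n α := by
  refine and_congr_right fun hα => ⟨fun h => ?_, fun h => ?_⟩
  · exact (height_nonneg_of_mem_closure h).lt_of_ne (height_ne_zero hα).symm
  · obtain ⟨i, j, hij, a, b, rfl⟩ := hα
    rcases hij.lt_or_gt with hlt | hlt
    · exact mem_closure_of_height_pos hlt a b h
    · rw [add_comm] at h ⊢
      exact mem_closure_of_height_pos hlt b a h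

theorem isPositiveSystem_dPosRoots (n : ℕ) :
    IsPositiveSystem (reflectionRep n) (dRoots n) (dPosRoots n) where
  finite := finite_dRoots n
  map_mem := reflectionRep_mem_dRoots
  neg_mem := neg_mem_dRoots
  mem_iff_neg_notMem {α} hα := by
    have := height_ne_zero hα
    rw [mem_dPosRoots_iff, mem_dPosRoots_iff, map_neg]
    simp only [hα, neg_mem_dRoots hα, true_and]
    omega

/-! ### The generators acting on roots -/

/-- The simple root `e_{i+1} - e_i` of the generator `s i`. -/
def simpleRoot (i : Fin (n - 1)) : Fin n → ℤ :=
  Pi.single ⟨i + 1, by omega⟩ 1 - Pi.single ⟨i, by omega⟩ 1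

@[simp]
theorem height_simpleRoot (i : Fin (n - 1)) : height n (simpleRoot i) = 1 := by
  simp [simpleRoot]

theorem simpleRoot_mem_dPosRoots (i : Fin (n - 1)) : simpleRoot i ∈ dPosRoots n :=
  ⟨⟨⟨i + 1, by omega⟩, ⟨i, by omega⟩, by simp, 1, -1, by
    simp [simpleRoot, Pi.single_neg, sub_eq_add_neg]⟩,
    AddSubmonoid.subset_closure (Or.inr ⟨i, rfl⟩)⟩

theorem reflectionRep_s (i : Fin (n - 1)) (v : Fin n → ℤ) :
    reflectionRep n (s i) v = v - (v ⬝ᵥ simpleRoot i) • simpleRoot i := by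
  have coeff : v ⬝ᵥ simpleRoot i = v ⟨i + 1, by omega⟩ - v ⟨i, by omega⟩ := by
    simp [simpleRoot, dotProduct_sub]
  rw [coeff]
  ext j
  rw [reflectionRep_apply]
  by_cases h₁ : j = ⟨i, by omega⟩
  · subst h₁; simp [s, simpleRoot]
  · by_cases h₂ : j = ⟨i + 1, by omega⟩
    · subst h₂; simp [s, simpleRoot]
    · simp [s, simpleRoot, Equiv.swap_apply_of_ne_of_ne h₁ h₂, h₁, h₂]

theorem reflectionRep_s_simpleRoot (i : Fin (n - 1)) :
    reflectionRep n (s i) (simpleRoot i) = -simpleRoot i := by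
  rw [reflectionRep_s, dotProduct_self_of_mem_dRoots (simpleRoot_mem_dPosRoots i).1, two_smul,
    sub_add_cancel_left]

theorem mul_s_eq_s_mul {w : SignedPerm n} {i j : Fin (n - 1)} (c : ℤˣ)
    (h : reflectionRep n w (simpleRoot i) = c • simpleRoot j) : w * s i = s j * w := by
  refine reflectionRep_injective (LinearMap.ext fun v => ?_)
  rw [Units.smul_def] at h
  rw [reflectionRep_mul_apply, reflectionRep_mul_apply, reflectionRep_s, reflectionRep_s, map_sub,
    map_smul, h, ← dotProduct_reflectionRep w v, h, dotProduct_smul, smul_smul, smul_eq_mul,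
    mul_right_comm, ← Units.val_mul, Int.units_mul_self, Units.val_one, one_mul]

theorem neg_reflectionRep_s_mem_dPosRoots_iff {α : Fin n → ℤ} (hα : α ∈ dPosRoots n)
    (i : Fin (n - 1)) : -reflectionRep n (s i) α ∈ dPosRoots n ↔ α = simpleRoot i := by
  constructor
  · intro hneg
    have pos := (mem_dPosRoots_iff.1 hα).2
    have neg := (mem_dPosRoots_iff.1 hneg).2
    rw [reflectionRep_s, map_neg, map_sub, map_smul, height_simpleRoot, smul_eq_mul] at neg
    exact eq_of_two_le_dotProduct hα.1 (simpleRoot_mem_dPosRoots i).1 (by omega)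
  · rintro rfl
    rwa [reflectionRep_s_simpleRoot, neg_neg]

theorem height_reflectionRep_t (v : Fin n → ℤ) :
    height n (reflectionRep n (t n) v) = height n v := by
  rw [height_apply, height_apply]
  refine Finset.sum_congr rfl fun i _ => ?_
  by_cases h : (i : ℕ) = 0 <;> simp [reflectionRep_apply, t, h]

theorem neg_reflectionRep_t_notMem_dPosRoots {α : Fin n → ℤ} (hα : α ∈ dPosRoots n) :
    -reflectionRep n (t n) α ∉ dPosRoots n := by
  rw [mem_dPosRoots_iff, map_neg, height_reflectionRep_t]
  have := (mem_dPosRoots_iff.1 hα).2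
  omega

/-- Kottwitz' sign for the trivial twist, with both arguments allowed to range over the whole group
of type `B_n`. -/
noncomputable def dSign (σ x : SignedPerm n) : ℚ :=
  kottwitzSign (reflectionRep n) id (dRoots n) (dPosRoots n) σ x

theorem dSign_t (σ : SignedPerm n) : dSign σ (t n) = 1 := by
  have no_inversion : {α | α ∈ twistedRoots (reflectionRep n) id (dRoots n) σ ∧
      α ∈ dPosRoots n ∧ -reflectionRep n (t n) α ∈ dPosRoots n} = ∅ :=
    Set.eq_empty_of_forall_notMem fun α hα => neg_reflectionRep_t_notMem_dPosRoots hα.2.1 hα.2.2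
  rw [dSign, kottwitzSign, no_inversion, Set.ncard_empty, pow_zero]

open Classical in
theorem dSign_s (σ : SignedPerm n) (i : Fin (n - 1)) :
    dSign σ (s i) = if reflectionRep n σ (simpleRoot i) = -simpleRoot i then -1 else 1 := by
  have inversions : {α | α ∈ twistedRoots (reflectionRep n) id (dRoots n) σ ∧
      α ∈ dPosRoots n ∧ -reflectionRep n (s i) α ∈ dPosRoots n} =
      {α | α = simpleRoot i ∧ reflectionRep n σ α = -α} := by
    ext α
    constructor
    · rintro ⟨⟨-, hneg⟩, hpos, hs⟩
      exact ⟨(neg_reflectionRep_s_mem_dPosRoots_iff hpos i).1 hs, hneg⟩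
    · rintro ⟨rfl, hneg⟩
      have hpos := simpleRoot_mem_dPosRoots i
      exact ⟨⟨hpos.1, hneg⟩, hpos, (neg_reflectionRep_s_mem_dPosRoots_iff hpos i).2 rfl⟩
  rw [dSign, kottwitzSign, inversions]
  split_ifs with h
  · have : {α | α = simpleRoot i ∧ reflectionRep n σ α = -α} = {simpleRoot i} :=
      Set.ext fun α => and_iff_left_of_imp fun hα => hα ▸ h
    rw [this, Set.ncard_singleton, pow_one]
  · have : {α | α = simpleRoot i ∧ reflectionRep n σ α = -α} = ∅ :=
      Set.eq_empty_of_forall_notMem fun α hα => h (hα.1 ▸ hα.2)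
    rw [this, Set.ncard_empty, pow_zero]

/-! ### Generation, length and the subgroup of type `D_n` -/

/-- The permutations of the basis vectors, as signed permutations. -/
def ofPerm : Equiv.Perm (Fin n) →* SignedPerm n where
  toFun p := ⟨p, fun _ => 1⟩
  map_one' := rfl
  map_mul' p q := by ext <;> simp

/-- The diagonal matrices with entries `±1`, as signed permutations. -/
def ofSign : (Fin n → ℤˣ) →* SignedPerm n where
  toFun e := ⟨1, e⟩
  map_one' := rfl
  map_mul' e f := by ext <;> simp

@[simp]
theorem ofSign_perm (e : Fin n → ℤˣ) : (ofSign e).perm = 1 := rfl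

@[simp]
theorem ofSign_sign (e : Fin n → ℤˣ) : (ofSign e).sign = e := rfl

theorem ofPerm_mul_ofSign (w : SignedPerm n) : ofPerm w.perm * ofSign w.sign = w := by
  ext <;> simp [ofPerm, ofSign]

theorem ofPerm_mul_ofSign_mul_inv (p : Equiv.Perm (Fin n)) (e : Fin n → ℤˣ) :
    ofPerm p * ofSign e * (ofPerm p)⁻¹ = ofSign (e ∘ ⇑p⁻¹) := by
  ext <;> simp [ofPerm, ofSign]

theorem t_eq_ofSign (hn : 0 < n) : t n = ofSign (Pi.mulSingle ⟨0, hn⟩ (-1)) := by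
  ext j
  · rfl
  · simp [t, Pi.mulSingle_apply, Fin.ext_iff]

theorem ofPerm_mem_mclosure (p : Equiv.Perm (Fin n)) :
    ofPerm p ∈ Submonoid.closure (generators n) := by
  obtain _ | m := n
  · rw [Subsingleton.elim p 1, map_one]
    exact one_mem _
  · have le_comap : Submonoid.closure (Set.range fun i : Fin m => Equiv.swap i.castSucc i.succ) ≤
        (Submonoid.closure (generators (m + 1))).comap ofPerm := by
      rw [Submonoid.closure_le, Set.range_subset_iff]
      exact fun i => Submonoid.subset_closure (Or.inr ⟨i, rfl⟩)
    rw [Equiv.Perm.mclosure_swap_castSucc_succ] at le_comap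
    exact le_comap (Submonoid.mem_top p)

theorem ofSign_mem_mclosure (e : Fin n → ℤˣ) :
    ofSign e ∈ Submonoid.closure (generators n) := by
  change e ∈ (Submonoid.closure (generators n)).comap ofSign
  rw [← Finset.univ_prod_mulSingle e]
  refine Submonoid.prod_mem _ fun i _ => Submonoid.mem_comap.2 ?_
  rcases Int.units_eq_one_or (e i) with h | h
  · rw [h, Pi.mulSingle_one, map_one]
    exact one_mem _
  · let p := Equiv.swap ⟨0, i.pos⟩ i
    have conj_t : ofPerm p * t n * ofPerm p⁻¹ = ofSign (Pi.mulSingle i (-1)) := by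
      rw [t_eq_ofSign i.pos, map_inv, ofPerm_mul_ofSign_mul_inv]
      congr 1
      ext j
      simp [p, Pi.mulSingle_apply, Equiv.swap_apply_eq_iff]
    rw [h, ← conj_t]
    exact mul_mem (mul_mem (ofPerm_mem_mclosure p) (Submonoid.subset_closure (Or.inl rfl)))
      (ofPerm_mem_mclosure p⁻¹)

theorem mclosure_generators (n : ℕ) : Submonoid.closure (generators n) = ⊤ := by
  rw [Submonoid.eq_top_iff']
  intro w
  rw [← ofPerm_mul_ofSign w]
  exact mul_mem (ofPerm_mem_mclosure _) (ofSign_mem_mclosure _)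

theorem exists_reduced_word (w : SignedPerm n) :
    ∃ l : List (SignedPerm n), (∀ g ∈ l, g ∈ generators n) ∧ l.prod = w ∧
      l.length = length w := by
  have hw : w ∈ Submonoid.closure (generators n) := mclosure_generators n ▸ Submonoid.mem_top w
  obtain ⟨l, hl, hprod⟩ := Submonoid.exists_list_of_mem_closure hw
  exact Nat.sInf_mem (s := {k | ∃ l : List (SignedPerm n), (∀ g ∈ l, g ∈ generators n) ∧
    l.prod = w ∧ l.length = k}) ⟨l.length, l, hl, hprod, rfl⟩

theorem length_prod_le (l : List (SignedPerm n)) (hl : ∀ g ∈ l, g ∈ generators n) :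
    length l.prod ≤ l.length :=
  Nat.sInf_le ⟨l, hl, rfl, rfl⟩

theorem s_mul_s (i : Fin (n - 1)) : s i * s i = (1 : SignedPerm n) := by
  ext j <;> simp [s]

/-- The exchange property: reading the word from the right, the letter that first makes the simple
root negative can be deleted. -/
theorem exists_shorter_word_mul_s (i : Fin (n - 1)) {l : List (SignedPerm n)}
    (hl : ∀ g ∈ l, g ∈ generators n)
    (h : -reflectionRep n l.prod (simpleRoot i) ∈ dPosRoots n) :
    ∃ l' : List (SignedPerm n), (∀ g ∈ l', g ∈ generators n) ∧ l'.prod = l.prod * s i ∧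
      l'.length < l.length := by
  induction l with
  | nil =>
    rw [List.prod_nil, map_one, Module.End.one_apply] at h
    have hpos := simpleRoot_mem_dPosRoots i
    exact absurd h (((isPositiveSystem_dPosRoots n).mem_iff_neg_notMem hpos.1).1 hpos)
  | cons g l ih =>
    obtain ⟨hg, htail⟩ := List.forall_mem_cons.1 hl
    rw [List.prod_cons, reflectionRep_mul_apply] at h
    by_cases hneg : -reflectionRep n l.prod (simpleRoot i) ∈ dPosRoots n
    · obtain ⟨l', hl', hprod, hlen⟩ := ih htail hneg
      refine ⟨g :: l', List.forall_mem_cons.2 ⟨hg, hl'⟩, ?_, Nat.succ_lt_succ hlen⟩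
      rw [List.prod_cons, List.prod_cons, hprod, mul_assoc]
    · have hpos : reflectionRep n l.prod (simpleRoot i) ∈ dPosRoots n :=
        ((isPositiveSystem_dPosRoots n).mem_iff_neg_notMem
          (reflectionRep_mem_dRoots _ (simpleRoot_mem_dPosRoots i).1)).2 hneg
      rcases hg with rfl | ⟨j, rfl⟩
      · exact absurd h (neg_reflectionRep_t_notMem_dPosRoots hpos)
      · have hroot := (neg_reflectionRep_s_mem_dPosRoots_iff hpos j).1 h
        refine ⟨l, htail, ?_, Nat.lt_succ_self _⟩
        rw [List.prod_cons, mul_assoc, mul_s_eq_s_mul 1 (hroot.trans (one_smul _ _).symm),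
          ← mul_assoc, s_mul_s, one_mul]

theorem length_mul_s_lt {w : SignedPerm n} {i : Fin (n - 1)}
    (h : -reflectionRep n w (simpleRoot i) ∈ dPosRoots n) : length (w * s i) < length w := by
  obtain ⟨l, hl, rfl, hlen⟩ := exists_reduced_word w
  obtain ⟨l', hl', hprod, hlt⟩ := exists_shorter_word_mul_s i hl h
  rw [← hprod, ← hlen]
  exact (length_prod_le l' hl').trans_lt hlt

theorem length_mul_s_lt_iff (w : SignedPerm n) (i : Fin (n - 1)) :
    length (w * s i) < length w ↔ -reflectionRep n w (simpleRoot i) ∈ dPosRoots n := by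
  refine ⟨fun hlt => by_contra fun hneg => ?_, length_mul_s_lt⟩
  have hpos : reflectionRep n w (simpleRoot i) ∈ dPosRoots n :=
    ((isPositiveSystem_dPosRoots n).mem_iff_neg_notMem
      (reflectionRep_mem_dRoots _ (simpleRoot_mem_dPosRoots i).1)).2 hneg
  have hgt : length (w * s i * s i) < length (w * s i) := by
    apply length_mul_s_lt
    rwa [reflectionRep_mul_apply, reflectionRep_s_simpleRoot, map_neg, neg_neg]
  rw [mul_assoc, s_mul_s, mul_one] at hgt
  exact hgt.not_gt hlt

theorem commute_and_length_lt_iff (σ : SignedPerm n) (i : Fin (n - 1)) :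
    s i * σ = σ * s i ∧ length (σ * s i) < length σ ↔
      reflectionRep n σ (simpleRoot i) = -simpleRoot i := by
  rw [length_mul_s_lt_iff, ← neg_eq_iff_eq_neg]
  constructor
  · rintro ⟨hcomm, hneg⟩
    refine (neg_reflectionRep_s_mem_dPosRoots_iff hneg i).1 ?_
    rwa [map_neg, ← reflectionRep_mul_apply, hcomm, reflectionRep_mul_apply,
      reflectionRep_s_simpleRoot, map_neg, neg_neg]
  · intro h
    refine ⟨(mul_s_eq_s_mul (-1) ?_).symm, by rw [h]; exact simpleRoot_mem_dPosRoots i⟩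
    rw [Units.neg_smul, one_smul, neg_eq_iff_eq_neg.1 h]

/-- The product of all signs. Its kernel is the subgroup of type `D_n`. -/
def signProd : SignedPerm n →* ℤˣ where
  toFun w := ∏ i, w.sign i
  map_one' := Finset.prod_const_one
  map_mul' v w := by
    simp only [mul_sign, Finset.prod_mul_distrib, Equiv.prod_comp w.perm v.sign]

theorem signProd_ofSign (e : Fin n → ℤˣ) : signProd (ofSign e) = ∏ i, e i := rfl

theorem signProd_s (i : Fin (n - 1)) : signProd (s i : SignedPerm n) = 1 := by
  simp [signProd, s]

theorem mem_D_or_mul_t_mem_D (w : SignedPerm n) : w ∈ D n ∨ w * t n ∈ D n := by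
  have hw : w ∈ Submonoid.closure (generators n) := mclosure_generators n ▸ Submonoid.mem_top w
  induction hw using Submonoid.closure_induction_left with
  | one => exact Or.inl (one_mem _)
  | mul_left g hg x _ ih =>
    rcases hg with rfl | ⟨i, rfl⟩
    · rcases ih with h | h
      · exact Or.inr (t_conj_mem h)
      · have := t_conj_mem h
        rw [mul_assoc, mul_assoc, t_mul_t, mul_one] at this
        exact Or.inl this
    · rw [mul_assoc]
      exact ih.imp (mul_mem (sD i).2) (mul_mem (sD i).2)

theorem mem_D_iff {w : SignedPerm n} : w ∈ D n ↔ signProd w = 1 := by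
  have D_le_ker : D n ≤ signProd.ker := by
    refine (Subgroup.closure_le _).2 ?_
    rintro _ (⟨h, rfl⟩ | ⟨i, rfl⟩) <;>
      simp [MonoidHom.mem_ker, signProd_s, Int.units_mul_self]
  refine ⟨fun h => D_le_ker h, fun h => (mem_D_or_mul_t_mem_D w).elim id fun hwt => ?_⟩
  have ht : signProd (t n) = 1 := by simpa [MonoidHom.mem_ker, h] using D_le_ker hwt
  rcases n.eq_zero_or_pos with rfl | hn
  · have : w = 1 := SignedPerm.ext (Subsingleton.elim _ _) (Subsingleton.elim _ _)
    exact this ▸ one_mem _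
  · rw [t_eq_ofSign hn, signProd_ofSign, Finset.prod_pi_mulSingle'] at ht
    simp at ht

theorem mul_t_mem_D {w : SignedPerm n} (h : signProd w = -1) : w * t n ∈ D n :=
  (mem_D_or_mul_t_mem_D w).resolve_left (by rw [mem_D_iff, h]; decide)

theorem exists_commute_of_odd_card {σ : SignedPerm n} {S : Finset (Fin n)} (hS : Odd S.card)
    (hσ : ∀ i, σ.perm i ∈ S ↔ i ∈ S) : ∃ c, c * t n ∈ D n ∧ Commute c σ := by
  refine ⟨ofSign fun i => if i ∈ S then -1 else 1, mul_t_mem_D ?_, ?_⟩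
  · rw [signProd_ofSign, Finset.prod_ite_mem, Finset.univ_inter, Finset.prod_const, hS.neg_one_pow]
  · ext i
    · rfl
    · simp [hσ, mul_comm]

/-! ### The involution module and its character -/

instance : Finite (SignedPerm n) :=
  Finite.of_injective (fun w : SignedPerm n => (w.perm, w.sign)) fun _ _ h =>
    SignedPerm.ext (congrArg Prod.fst h) (congrArg Prod.snd h)

section ConjugacyClass

open MulAction

variable {C : ConjClasses (SignedPerm n)}

instance : MulAction (SignedPerm n) C.carrier where
  smul := conjBy
  one_smul σ := Subtype.ext (by simp [HSMul.hSMul, conjBy])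
  mul_smul x y σ := Subtype.ext (by simp [HSMul.hSMul, conjBy, mul_assoc])

theorem coe_smul (x : SignedPerm n) (σ : C.carrier) :
    ((x • σ : C.carrier) : SignedPerm n) = x * σ * x⁻¹ := rfl

theorem smul_eq_self_iff {x : SignedPerm n} {σ : C.carrier} :
    x • σ = σ ↔ Commute x (σ : SignedPerm n) := by
  rw [Subtype.ext_iff, coe_smul, mul_inv_eq_iff_eq_mul, commute_iff_eq]

instance : IsPretransitive (SignedPerm n) C.carrier where
  exists_smul_eq σ τ := by
    obtain ⟨x, hx⟩ := isConj_iff.1 (ConjClasses.mk_eq_mk_iff_isConj.1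
      ((ConjClasses.mem_carrier_iff_mk_eq.1 σ.2).trans
        (ConjClasses.mem_carrier_iff_mk_eq.1 τ.2).symm))
    exact ⟨x, Subtype.ext hx⟩

theorem isCocycle_dSign (C : ConjClasses (SignedPerm n)) :
    IsCocycle fun (x : SignedPerm n) (σ : C.carrier) => dSign σ x where
  one σ := kottwitzSign_one (isPositiveSystem_dPosRoots n) σ
  mul x y σ := kottwitzSign_mul (isPositiveSystem_dPosRoots n) σ x y

variable {M : Type*} [AddCommGroup M] [Module ℚ M] {b : Module.Basis C.carrier ℚ M}
  {ρ ρ' : Representation ℚ (SignedPerm n) M}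

theorem isInvolutionModule_monomialRep (b : Module.Basis C.carrier ℚ M) :
    IsInvolutionModule b (monomialRep (isCocycle_dSign C) b) := by
  classical
  refine ⟨fun σ => ?_, fun i σ => ?_⟩
  · rw [monomialRep_apply_basis, dSign_t, one_smul]
    rfl
  · rw [monomialRep_apply_basis, dSign_s, if_congr (commute_and_length_lt_iff _ _) rfl rfl]
    split_ifs with h
    · have fixed : s i • σ = σ := smul_eq_self_iff.2 ((commute_and_length_lt_iff _ i).2 h).1
      rw [fixed, neg_one_smul]
    · rw [one_smul]
      rfl

theorem IsInvolutionModule.eq (h : IsInvolutionModule b ρ) (h' : IsInvolutionModule b ρ') :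
    ρ = ρ' := by
  refine MonoidHom.eq_of_eqOn_denseM (mclosure_generators n) ?_
  rintro _ (rfl | ⟨i, rfl⟩)
  · exact b.ext fun σ => (h.1 σ).trans (h'.1 σ).symm
  · exact b.ext fun σ => (h.2 i σ).trans (h'.2 i σ).symm

theorem IsInvolutionModule.character_eq_finsum (h : IsInvolutionModule b ρ) (g : SignedPerm n) :
    ρ.character g = ∑ᶠ σ ∈ fixedBy C.carrier g, dSign σ g := by
  rw [h.eq (isInvolutionModule_monomialRep b), character_monomialRep]

/-! ### Kottwitz' characters as sums over orbits -/

theorem splitCharacter_eq_finsum {w : D n} {σ : C.carrier} (h : (w : SignedPerm n) = σ)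
    (g : D n) :
    splitCharacter w g =
      ∑ᶠ τ ∈ orbit (D n) σ ∩ fixedBy C.carrier g, dSign (τ : SignedPerm n) g := by
  have centralizer_eq : twistedCentralizer (MulEquiv.refl (D n)) w =
      stabilizer (D n) σ := by
    ext x
    rw [mem_stabilizer_iff, Subgroup.smul_def, smul_eq_self_iff, ← h]
    exact Subtype.ext_iff
  have sign_eq (x : D n) : kottwitzSign (dRep n) id (dRoots n) (dPosRoots n) w x =
      dSign (σ : SignedPerm n) x := by
    rw [dSign, ← h]
    rfl
  rw [splitCharacter, kottwitzCharacter, centralizer_eq]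
  simp only [sign_eq]
  exact inducedClassFunction_stabilizer ((isCocycle_dSign C).restrict (D n)) σ g

theorem t_mul_t_mul (w : SignedPerm n) : t n * (t n * w) = w := by
  rw [← mul_assoc, t_mul_t, one_mul]

theorem reflectionRep_t_t (v : Fin n → ℤ) :
    reflectionRep n (t n) (reflectionRep n (t n) v) = v := by
  rw [← reflectionRep_mul_apply, t_mul_t, map_one, Module.End.one_apply]

theorem quasiSplitCharacter_eq_finsum {w : D n} {σ : C.carrier} (h : t n * w = σ) (g : D n) :
    quasiSplitCharacter w g =
      ∑ᶠ τ ∈ orbit (D n) σ ∩ fixedBy C.carrier g, dSign (τ : SignedPerm n) g := by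
  have centralizer_eq : twistedCentralizer (diamond n) w = stabilizer (D n) σ := by
    ext x
    rw [mem_stabilizer_iff, Subgroup.smul_def, smul_eq_self_iff, ← h, commute_iff_eq,
      ← mul_right_inj (t n), mul_assoc (t n) (w : SignedPerm n), t_mul_t_mul]
    simp only [← mul_assoc]
    exact Subtype.ext_iff
  have roots_eq : twistedRoots (dRep n) (reflectionRep n (t n)) (dRoots n) w =
      twistedRoots (reflectionRep n) id (dRoots n) σ := by
    ext α
    refine and_congr_right fun _ => ?_
    rw [← h, reflectionRep_mul_apply, id_eq,
      ← (Function.LeftInverse.injective (reflectionRep_t_t (n := n))).eq_iff, map_neg,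
      reflectionRep_t_t]
    rfl
  have sign_eq (x : D n) : kottwitzSign (dRep n) (reflectionRep n (t n)) (dRoots n) (dPosRoots n)
      w x = dSign (σ : SignedPerm n) x := by
    rw [kottwitzSign, roots_eq]
    rfl
  rw [quasiSplitCharacter, kottwitzCharacter, centralizer_eq]
  simp only [sign_eq]
  exact inducedClassFunction_stabilizer ((isCocycle_dSign C).restrict (D n)) σ g

/-! ### Conjugacy classes of `B_n` as orbits of the subgroup of type `D_n` -/

theorem orbit_union_orbit_t_smul (σ : C.carrier) :
    orbit (D n) σ ∪ orbit (D n) (t n • σ) = Set.univ := by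
  refine Set.eq_univ_of_forall fun τ => ?_
  obtain ⟨x, rfl⟩ := exists_smul_eq (SignedPerm n) σ τ
  refine (mem_D_or_mul_t_mem_D x).imp (fun h => ⟨⟨x, h⟩, rfl⟩) fun h => ⟨⟨x * t n, h⟩, ?_⟩
  change (x * t n) • t n • σ = x • σ
  rw [smul_smul, mul_assoc, t_mul_t, mul_one]

theorem isPretransitive_of_t_smul_mem_orbit {σ : C.carrier} (h : t n • σ ∈ orbit (D n) σ) :
    IsPretransitive (D n) C.carrier := by
  rw [isPretransitive_iff_orbit_eq_univ σ, ← orbit_union_orbit_t_smul σ, orbit_eq_iff.2 h,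
    Set.union_self]

theorem isPretransitive_of_commute {c : SignedPerm n} (hc : c * t n ∈ D n) {σ : C.carrier}
    (h : Commute c (σ : SignedPerm n)) : IsPretransitive (D n) C.carrier := by
  have ht : t n * c ∈ D n := by simpa only [mul_assoc, t_mul_t, mul_one] using t_conj_mem hc
  have smul_eq : (t n * c) • σ = t n • σ := by rw [mul_smul, smul_eq_self_iff.2 h]
  exact isPretransitive_of_t_smul_mem_orbit ⟨⟨t n * c, ht⟩, smul_eq⟩

theorem exists_smul_eq_iff_isConj {w₁ w₂ : D n} (h₁ : (w₁ : SignedPerm n) ∈ C.carrier)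
    (h₂ : (w₂ : SignedPerm n) ∈ C.carrier) :
    (∃ x : D n, x • (⟨w₁, h₁⟩ : C.carrier) = ⟨w₂, h₂⟩) ↔ IsConj w₁ w₂ := by
  rw [isConj_iff]
  exact exists_congr fun x => Subtype.ext_iff.trans (Subtype.ext_iff (a1 := x * w₁ * x⁻¹)).symm

theorem isPretransitive_of_carrier_eq {w : D n}
    (h : C.carrier = ((↑) : D n → SignedPerm n) '' conjugatesOf w) :
    IsPretransitive (D n) C.carrier where
  exists_smul_eq := by
    rintro ⟨σ, hσ⟩ ⟨τ, hτ⟩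
    obtain ⟨v, hv, rfl⟩ := h ▸ hσ
    obtain ⟨v', hv', rfl⟩ := h ▸ hτ
    exact (exists_smul_eq_iff_isConj hσ hτ).2 (hv.symm.trans hv')

theorem not_isPretransitive_of_carrier_eq {w₁ w₂ : D n} (hw : ¬IsConj w₁ w₂)
    (h : C.carrier = ((↑) : D n → SignedPerm n) '' (conjugatesOf w₁ ∪ conjugatesOf w₂)) :
    ¬IsPretransitive (D n) C.carrier := by
  have h₁ : (w₁ : SignedPerm n) ∈ C.carrier := h ▸ ⟨w₁, Or.inl (IsConj.refl w₁), rfl⟩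
  have h₂ : (w₂ : SignedPerm n) ∈ C.carrier := h ▸ ⟨w₂, Or.inr (IsConj.refl w₂), rfl⟩
  exact fun _ => hw ((exists_smul_eq_iff_isConj h₁ h₂).1 (exists_smul_eq _ _ _))

theorem not_odd_card_of_not_isPretransitive (h : ¬IsPretransitive (D n) C.carrier)
    (σ : C.carrier) {S : Finset (Fin n)} (hσ : ∀ i, (σ : SignedPerm n).perm i ∈ S ↔ i ∈ S) :
    ¬Odd S.card := by
  intro hS
  obtain ⟨c, hc, hcomm⟩ := exists_commute_of_odd_card hS hσ
  exact h (isPretransitive_of_commute hc hcomm)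

theorem even_of_not_isPretransitive (h : ¬IsPretransitive (D n) C.carrier) : Even n := by
  obtain ⟨σ, hσ⟩ := nonempty_carrier C
  have := not_odd_card_of_not_isPretransitive h ⟨σ, hσ⟩ (S := Finset.univ) (by simp)
  rwa [Finset.card_univ, Fintype.card_fin, Nat.not_odd_iff_even] at this

theorem perm_ne_of_not_isPretransitive (h : ¬IsPretransitive (D n) C.carrier) (σ : C.carrier)
    (i : Fin n) : (σ : SignedPerm n).perm i ≠ i := by
  intro hi
  refine not_odd_card_of_not_isPretransitive h σ (S := {i}) (fun j => ?_) (by simp)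
  rw [Finset.mem_singleton, Finset.mem_singleton]
  conv_lhs => rw [← hi]
  exact (σ : SignedPerm n).perm.injective.eq_iff

theorem IsInvolutionModule.character_eq_splitCharacter [IsPretransitive (D n) C.carrier]
    (h : IsInvolutionModule b ρ) {w : D n} (hw : (w : SignedPerm n) ∈ C.carrier) (g : D n) :
    ρ.character g = splitCharacter w g := by
  rw [h.character_eq_finsum, splitCharacter_eq_finsum (σ := ⟨w, hw⟩) rfl, orbit_eq_univ,
    Set.univ_inter]
  rfl

theorem IsInvolutionModule.character_eq_splitCharacter_add (h : IsInvolutionModule b ρ)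
    (htrans : ¬IsPretransitive (D n) C.carrier) {w : D n} (hw : (w : SignedPerm n) ∈ C.carrier)
    (g : D n) : ρ.character g = splitCharacter w g + splitCharacter (diamond n w) g := by
  let σ : C.carrier := ⟨w, hw⟩
  have diamond_eq : (diamond n w : SignedPerm n) = (t n • σ : C.carrier) := by
    rw [coe_smul, inv_eq_of_mul_eq_one_left (t_mul_t n)]
    rfl
  have disjoint : Disjoint (orbit (D n) σ ∩ fixedBy C.carrier g)
      (orbit (D n) (t n • σ) ∩ fixedBy C.carrier g) := by
    refine (orbit.eq_or_disjoint σ (t n • σ)).resolve_left (fun heq => htrans ?_) |>.mono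
      Set.inter_subset_left Set.inter_subset_left
    exact isPretransitive_of_t_smul_mem_orbit (orbit_eq_iff.1 heq.symm)
  rw [h.character_eq_finsum, splitCharacter_eq_finsum (σ := σ) rfl,
    splitCharacter_eq_finsum diamond_eq, ← finsum_mem_union disjoint (Set.toFinite _)
      (Set.toFinite _), ← Set.union_inter_distrib_right, orbit_union_orbit_t_smul, Set.univ_inter]
  rfl

/-! ### The element `σ_{n/2}` -/

theorem sigmaHalf_eq_ofPerm :
    ofPerm (sigmaHalf n : SignedPerm n).perm = (sigmaHalf n : SignedPerm n) := by
  have mem_range : sigmaHalf n ∈ (ofPerm (n := n)).range.comap (D n).subtype := by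
    refine Subgroup.list_prod_mem _ fun x hx => ?_
    obtain ⟨k, rfl⟩ := (List.mem_ofFn' _ _).1 hx
    exact ⟨_, rfl⟩
  obtain ⟨p, hp⟩ := mem_range
  change ofPerm p = (sigmaHalf n : SignedPerm n) at hp
  rw [← hp]
  rfl

theorem prod_s_two_mul_perm_apply (m : ℕ) (hm : m ≤ n / 2) (j : Fin n) :
    ((((List.ofFn fun k : Fin m => sD (n := n) ⟨2 * k, by omega⟩).prod : D n) :
      SignedPerm n).perm j : ℕ) =
      if (j : ℕ) < 2 * m then if (j : ℕ) % 2 = 0 then (j : ℕ) + 1 else j - 1 else j := by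
  induction m generalizing j with
  | zero => simp
  | succ m ih =>
    have last_apply : ((sD ⟨2 * m, by omega⟩ : D n) : SignedPerm n).perm j =
        if (j : ℕ) = 2 * m then ⟨2 * m + 1, by omega⟩ else
          if (j : ℕ) = 2 * m + 1 then ⟨2 * m, by omega⟩ else j := by
      change Equiv.swap _ _ j = _
      simp only [Equiv.swap_apply_def, Fin.ext_iff]
    simp only [List.ofFn_succ', List.concat_eq_append, List.prod_append, List.prod_singleton,
      Subgroup.coe_mul, mul_perm, Equiv.Perm.mul_apply, Fin.val_castSucc, Fin.val_last]
    rw [ih (by omega), last_apply]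
    split_ifs <;> simp_all <;> omega

theorem sigmaHalf_perm_apply (hn : Even n) (j : Fin n) :
    ((sigmaHalf n : SignedPerm n).perm j : ℕ) = if (j : ℕ) % 2 = 0 then (j : ℕ) + 1 else j - 1 := by
  have := prod_s_two_mul_perm_apply (n / 2) le_rfl j
  rwa [Nat.two_mul_div_two_of_even hn, if_pos j.2] at this

theorem isConj_of_sq_eq_one_of_forall_ne {p q : Equiv.Perm (Fin n)} (hp : p ^ 2 = 1)
    (hq : q ^ 2 = 1) (hp' : ∀ i, p i ≠ i) (hq' : ∀ i, q i ≠ i) : IsConj p q := by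
  have two_mul_card {r : Equiv.Perm (Fin n)} (hr : r ^ 2 = 1) (hr' : ∀ i, r i ≠ i) :
      r.cycleType.card * 2 = n := by
    have hsum := r.sum_cycleType
    rwa [Equiv.Perm.cycleType_of_pow_prime_eq_one hr, Multiset.sum_replicate, smul_eq_mul,
      Finset.eq_univ_of_forall fun i => Equiv.Perm.mem_support.2 (hr' i), Finset.card_univ,
      Fintype.card_fin] at hsum
  rw [Equiv.Perm.isConj_iff_cycleType_eq, Equiv.Perm.cycleType_of_pow_prime_eq_one hp,
    Equiv.Perm.cycleType_of_pow_prime_eq_one hq,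
    Nat.mul_right_cancel two_pos ((two_mul_card hp hp').trans (two_mul_card hq hq').symm)]

/-- One vector in each pair `{i, σ i}` can be negated to make all signs of `σ` positive. -/
theorem isConj_ofPerm_perm {σ : SignedPerm n} (hσ : σ * σ = 1) (hfix : ∀ i, σ.perm i ≠ i) :
    IsConj σ (ofPerm σ.perm) := by
  have perm_perm (i : Fin n) : σ.perm (σ.perm i) = i := congr(($hσ).perm i)
  have sign_mul_sign (i : Fin n) : σ.sign (σ.perm i) * σ.sign i = 1 := congr(($hσ).sign i)
  refine isConj_iff.2 ⟨ofSign fun i => if i < σ.perm i then 1 else σ.sign i, ?_⟩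
  rw [mul_inv_eq_iff_eq_mul]
  ext i
  · simp [ofPerm]
  · rcases lt_or_gt_of_ne (hfix i) with h | h <;>
      simp [ofPerm, perm_perm, sign_mul_sign, h, h.not_gt]

theorem isConj_sigmaHalf (hn : Even n) {σ : SignedPerm n} (hσ : σ * σ = 1)
    (hfix : ∀ i, σ.perm i ≠ i) : IsConj σ (sigmaHalf n : SignedPerm n) := by
  have sigmaHalf_sq : (sigmaHalf n : SignedPerm n).perm ^ 2 = 1 := by
    ext j
    rw [pow_two, Equiv.Perm.mul_apply, sigmaHalf_perm_apply hn, sigmaHalf_perm_apply hn,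
      Equiv.Perm.one_apply]
    split_ifs <;> omega
  have sigmaHalf_ne (j : Fin n) : (sigmaHalf n : SignedPerm n).perm j ≠ j := by
    rw [Fin.ne_iff_vne, sigmaHalf_perm_apply hn]
    split_ifs <;> omega
  have perm_sq : σ.perm ^ 2 = 1 := (pow_two _).trans congr(($hσ).perm)
  rw [← sigmaHalf_eq_ofPerm]
  exact (isConj_ofPerm_perm hσ hfix).trans (ofPerm.map_isConj
    (isConj_of_sq_eq_one_of_forall_ne perm_sq sigmaHalf_sq hfix sigmaHalf_ne))

theorem sigmaHalf_mem_carrier (hC : ∀ σ ∈ C.carrier, σ * σ = 1)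
    (h : ¬IsPretransitive (D n) C.carrier) : (sigmaHalf n : SignedPerm n) ∈ C.carrier := by
  obtain ⟨σ, hσ⟩ := nonempty_carrier C
  obtain ⟨x, hx⟩ := isConj_iff.1 (isConj_sigmaHalf (even_of_not_isPretransitive h) (hC σ hσ)
    (perm_ne_of_not_isPretransitive h ⟨σ, hσ⟩))
  exact hx ▸ (x • (⟨σ, hσ⟩ : C.carrier)).2

/-! ### Classes in the coset of `t` -/

theorem image_setOf_t_mul_mem (hC : ∀ σ ∈ C.carrier, ∃ w ∈ D n, σ = w * t n) :
    ((↑) : D n → SignedPerm n) '' {w | t n * w ∈ C.carrier} =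
      (fun σ => t n * σ) '' C.carrier := by
  ext τ
  constructor
  · rintro ⟨w, hw, rfl⟩
    exact ⟨t n * w, hw, t_mul_t_mul _⟩
  · rintro ⟨σ, hσ, rfl⟩
    obtain ⟨w, hw, rfl⟩ := hC σ hσ
    refine ⟨diamond n ⟨w, hw⟩, ?_, mul_assoc _ _ _⟩
    change t n * (t n * w * t n) ∈ C.carrier
    rwa [mul_assoc, t_mul_t_mul]

theorem isPretransitive_of_t_mul_mem {w : D n} (hw : t n * w ∈ C.carrier) :
    IsPretransitive (D n) C.carrier := by
  have hc : t n * w * t n ∈ D n := t_conj_mem w.2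
  exact isPretransitive_of_commute hc (σ := ⟨_, hw⟩) (Commute.refl _)

theorem isTwistedConjClass_setOf_t_mul_mem (hC : ∀ σ ∈ C.carrier, ∃ w ∈ D n, σ = w * t n) :
    IsTwistedConjClass (diamond n) {w : D n | t n * w ∈ C.carrier} := by
  obtain ⟨σ, hσ⟩ := nonempty_carrier C
  obtain ⟨w, hw, -⟩ := (image_setOf_t_mul_mem hC).symm ▸ Set.mem_image_of_mem (t n * ·) hσ
  have := isPretransitive_of_t_mul_mem hw
  refine ⟨w, Set.ext fun v => ⟨fun hv => ?_, ?_⟩⟩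
  · obtain ⟨x, hx⟩ := exists_smul_eq (D n) (⟨_, hw⟩ : C.carrier) ⟨_, hv⟩
    have conj_eq : (x : SignedPerm n) * (t n * w) * (x : SignedPerm n)⁻¹ = t n * v :=
      congrArg Subtype.val hx
    refine ⟨x, Subtype.ext ?_⟩
    change (v : SignedPerm n) = t n * x * t n * w * (x : SignedPerm n)⁻¹
    rw [← t_mul_t_mul (v : SignedPerm n), ← conj_eq]
    simp only [mul_assoc]
  · rintro ⟨x, rfl⟩
    have conj_mem := ((x : SignedPerm n) • (⟨_, hw⟩ : C.carrier)).2
    rw [coe_smul] at conj_mem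
    change t n * (t n * x * t n * w * (x : SignedPerm n)⁻¹) ∈ C.carrier
    simpa only [mul_assoc, t_mul_t_mul] using conj_mem

theorem IsInvolutionModule.character_eq_quasiSplitCharacter (h : IsInvolutionModule b ρ) {w : D n}
    (hw : t n * w ∈ C.carrier) (g : D n) : ρ.character g = quasiSplitCharacter w g := by
  have := isPretransitive_of_t_mul_mem hw
  let σ : C.carrier := ⟨t n * w, hw⟩
  rw [h.character_eq_finsum, quasiSplitCharacter_eq_finsum (σ := σ) rfl, orbit_eq_univ,
    Set.univ_inter]
  rfl

end ConjugacyClass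

theorem isTwistedInvolution_diamond_iff {w : D n} :
    IsTwistedInvolution (diamond n) w ↔ (t n * w) * (t n * w) = (1 : SignedPerm n) := by
  rw [IsTwistedInvolution, eq_inv_iff_mul_eq_one, Subtype.ext_iff, ← mul_assoc]
  rfl

end SignedPerm

open SignedPerm Kottwitz in
theorem lemma4p3_general (n : ℕ) (C : ConjClasses (SignedPerm n))
    {M : Type*} [AddCommGroup M] [Module ℚ M] (b : Module.Basis C.carrier ℚ M) :
    (∃! ρ : Representation ℚ (SignedPerm n) M, IsInvolutionModule b ρ) ∧
    ∀ ρ : Representation ℚ (SignedPerm n) M, IsInvolutionModule b ρ →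
      (∀ w : D n, C.carrier = ((↑) : D n → SignedPerm n) '' conjugatesOf w →
        ∀ g : D n, ρ.character g = splitCharacter w g) ∧
      (∀ w₁ w₂ : D n, ¬IsConj w₁ w₂ →
        C.carrier = ((↑) : D n → SignedPerm n) '' (conjugatesOf w₁ ∪ conjugatesOf w₂) →
        Even n ∧ ∀ w : D n, (w : SignedPerm n) ∈ C.carrier → ∀ g : D n,
          ρ.character g = splitCharacter w g + splitCharacter (diamond n w) g) ∧
      ((∀ σ ∈ C.carrier, ∃ w ∈ D n, σ = w * t n) →
        ((↑) : D n → SignedPerm n) '' {w | t n * w ∈ C.carrier} =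
            (fun σ => t n * σ) '' C.carrier ∧
          IsTwistedConjClass (diamond n) {w : D n | t n * w ∈ C.carrier} ∧
          ∀ w : D n, t n * w ∈ C.carrier → ∀ g : D n,
            ρ.character g = quasiSplitCharacter w g) := by
  refine ⟨⟨_, isInvolutionModule_monomialRep b,
    fun ρ hρ => hρ.eq (isInvolutionModule_monomialRep b)⟩, fun ρ hρ => ⟨?_, ?_, ?_⟩⟩
  · intro w hw
    have := isPretransitive_of_carrier_eq hw
    exact hρ.character_eq_splitCharacter (hw ▸ ⟨w, IsConj.refl w, rfl⟩)
  · intro w₁ w₂ hne hw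
    have htrans := not_isPretransitive_of_carrier_eq hne hw
    exact ⟨even_of_not_isPretransitive htrans, fun w => hρ.character_eq_splitCharacter_add htrans⟩
  · intro hC
    exact ⟨image_setOf_t_mul_mem hC, isTwistedConjClass_setOf_t_mul_mem hC,
      fun w => hρ.character_eq_quasiSplitCharacter⟩

theorem lemma4p3 (n : ℕ) (C : ConjClasses (SignedPerm n))
    (hC : ∀ σ ∈ C.carrier, σ * σ = 1)
    {M : Type*} [AddCommGroup M] [Module ℚ M] (b : Module.Basis C.carrier ℚ M) :
    (∃! ρ : Representation ℚ (SignedPerm n) M, SignedPerm.IsInvolutionModule b ρ) ∧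
    ∀ ρ : Representation ℚ (SignedPerm n) M, SignedPerm.IsInvolutionModule b ρ →
      -- (a)
      (∀ w : SignedPerm.D n,
        C.carrier = ((↑) : SignedPerm.D n → SignedPerm n) '' conjugatesOf w →
        ∀ g : SignedPerm.D n, ρ.character g = SignedPerm.splitCharacter w g) ∧
      -- (b)
      (∀ w₁ w₂ : SignedPerm.D n, ¬ IsConj w₁ w₂ →
        C.carrier = ((↑) : SignedPerm.D n → SignedPerm n) '' (conjugatesOf w₁ ∪ conjugatesOf w₂) →
        Even n ∧ ∀ g : SignedPerm.D n, ρ.character g =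
          SignedPerm.splitCharacter (SignedPerm.sigmaHalf n) g +
          SignedPerm.splitCharacter (SignedPerm.diamond n (SignedPerm.sigmaHalf n)) g) ∧
      -- (c)
      ((∀ σ ∈ C.carrier, ∃ w ∈ SignedPerm.D n, σ = w * SignedPerm.t n) →
        ∃ K : Set (SignedPerm.D n),
          ((↑) : SignedPerm.D n → SignedPerm n) '' K =
            (fun σ => SignedPerm.t n * σ) '' C.carrier ∧
          Kottwitz.IsTwistedConjClass (SignedPerm.diamond n) K ∧
          (∀ w ∈ K, Kottwitz.IsTwistedInvolution (SignedPerm.diamond n) w) ∧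
          ∀ w ∈ K, ∀ g : SignedPerm.D n,
            ρ.character g = SignedPerm.quasiSplitCharacter w g) := by
  obtain ⟨existsUnique, characters⟩ := lemma4p3_general n C b
  refine ⟨existsUnique, fun ρ hρ => ?_⟩
  obtain ⟨unsplit, split, quasiSplit⟩ := characters ρ hρ
  refine ⟨unsplit, fun w₁ w₂ hne hw => ?_, fun hCt => ?_⟩
  · have mem := SignedPerm.sigmaHalf_mem_carrier hC
      (SignedPerm.not_isPretransitive_of_carrier_eq hne hw)
    exact (split w₁ w₂ hne hw).imp_right fun character_eq => character_eq _ mem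
  · obtain ⟨image_eq, isClass, character_eq⟩ := quasiSplit hCt
    exact ⟨_, image_eq, isClass,
      fun w hw => SignedPerm.isTwistedInvolution_diamond_iff.2 (hC _ hw), character_eq⟩
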